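/- Let "regular" mean $C^\infty$ throughout, or real analytic throughout. Let $\Omega\subseteq\mathbb{C}^5$ be open, let $\rho:\Omega\to\mathbb{R}$ be regular, and let $M=M^9=\{\rho=0\}$, with $d\rho\neq0$ at every point of $M$. Let $J$ be the standard complex structure of $\mathbb{C}^5$, $T^cM=TM\cap J\,TM$, and $\theta=\sqrt{-1}\,\bar\partial\rho|_M$, a real $1$-form with kernel $T^cM$. Let $\alpha^1,\dots,\alpha^4$ be regular complex-valued $1$-forms on $M$ that are of type $(1,0)$ (complex linear on $T^cM$), linearly independent on $T^cM$ at every point of $M$, and diagonalise the Levi form with signature $(2,2)$: $$d\theta\equiv\sqrt{-1}\,(\alpha^1\wedge\bar\alpha^1+\alpha^2\wedge\bar\alpha^2-\alpha^3\wedge\bar\alpha^3-\alpha^4\wedge\bar\alpha^4)\pmod\theta .$$ On $M\times U(2)$, with $\begin{pmatrix}P&Q\\R&S\end{pmatrix}\in U(2)$, put $$\omega^0=\theta,\qquad \omega^3=\alpha^3-P\alpha^1-Q\alpha^2,\qquad \omega^4=\alpha^4-R\alpha^1-S\alpha^2 .$$ Let $\mathbb{D}^2\subset\mathbb{C}^2$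 be the bidisk with holomorphic coordinates $(s,t)$, and let $\pi:M\times U(2)\to M$ be the projection. Let $\varphi:\mathbb{D}^2\to M$ be a regular immersion of real manifolds whose image contains the origin. A lift of $\varphi$ is a regular map $\tilde\varphi:\mathbb{D}^2\to M\times U(2)$ with $\pi\circ\tilde\varphi=\varphi$. Call $\varphi$ a holomorphic immersion if for every $y\in\mathbb{D}^2$ the space $\varphi_*T_y\mathbb{D}^2$ is invariant under $J$ and contained in $\ker\theta$. Consider the condition $$0=\tilde\varphi^*\omega^0=\tilde\varphi^*\omega^3=\tilde\varphi^*\omega^4=\tilde\varphi^*\bar\omega^3=\tilde\varphi^*\bar\omega^4 .\tag{$*$}$$ **Proposition 3.8.** 1. If $\varphi$ is a holomorphic immersion, then it has exactly one lift $\tilde\varphi$ that satisfies $(*)$. If moreover $\varphi$ is holomorphic as a map, and $f_i=\alpha^i(\varphi_*\partial_s)$, $g_i=\alpha^i(\varphi_*\partial_t)$ for $1\le i\le4$, then $\begin{pmatrix}f_1&g_1\\f_2&g_2\end{pmatrix}$ is invertible at every point of $\mathbb{D}^2$ and this lift is $$\tilde\varphi(y)=\left(\varphi(y),\begin{pmatrix}f_3&g_3\\f_4&g_4\end{pmatrix}\begin{pmatrix}f_1&g_1\\f_2&g_2\end{pmatrix}^{-1}\right).$$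 2. Conversely, if some lift $\tilde\varphi$ of $\varphi$ satisfies $(*)$, then $\varphi$ is a holomorphic immersion and its image is an (immersed) complex manifold of dimension $2$: every $y\in\mathbb{D}^2$ has an open neighbourhood $V\subseteq\mathbb{D}^2$ such that $\varphi(V)$ is a $2$-dimensional complex submanifold of $\mathbb{C}^5$; and if $\varphi$ is a topological embedding, then $\varphi(\mathbb{D}^2)$ itself is a $2$-dimensional complex submanifold of $\mathbb{C}^5$. -/

import Mathlib

open scoped ContDiff Matrix ComplexConjugate

attribute [local instance] Matrix.normedAddCommGroup Matrix.normedSpace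

namespace BidiskLift

noncomputable section

/-- The ambient space `ℂ⁵`, with holomorphic coordinates `z 0, …, z 4`. -/
abbrev C5 : Type := Fin 5 → ℂ

/-- The complex `2 × 2` matrices; `U(2)` is `Matrix.unitaryGroup (Fin 2) ℂ`. -/
abbrev Mat2 : Type := Matrix (Fin 2) (Fin 2) ℂ

/-- The bidisk `𝔻 × 𝔻`, with holomorphic coordinates `(s, t)`. -/
def bidisk : Set (ℂ × ℂ) := Metric.ball 0 1 ×ˢ Metric.ball 0 1

/-- The standard complex structure `J` of `ℂ⁵`: multiplication by `√-1`. -/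
def J : C5 →L[ℝ] C5 := (Complex.I • ContinuousLinearMap.id ℂ C5).restrictScalars ℝ

/-! ### The real hypersurface, its contact form and its adapted coframes -/

/-- The hypersurface `{ρ = 0}` in the domain `Ω` of the defining function `ρ`. -/
def hypersurface (Ω : Set C5) (ρ : C5 → ℝ) : Set C5 := {p | p ∈ Ω ∧ ρ p = 0}

/-- `ρ` is a defining function of class `C^n` on the open set `Ω` of a real hypersurface. -/
structure IsDefiningFunction (n : WithTop ℕ∞) (Ω : Set C5) (ρ : C5 → ℝ) : Prop where
  isOpen : IsOpen Ω
  contDiffOn : ContDiffOn ℝ n ρ Ω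
  fderiv_ne_zero : ∀ p ∈ hypersurface Ω ρ, fderiv ℝ ρ p ≠ 0

/-- The complex tangent space `T^c_p M = T_p M ∩ J⁻¹ (T_p M)` of `M = {ρ = 0}`, where
`T_p M` is the kernel of `dρ_p`. -/
def complexTangent (ρ : C5 → ℝ) (p : C5) : Set C5 :=
  {v | fderiv ℝ ρ p v = 0 ∧ fderiv ℝ ρ p (J v) = 0}

/-- The `(0,1)`-form `∂̄ρ`, that is `∂̄ρ (v) = (dρ (v) + √-1 dρ (J v)) / 2`. -/
def dbar (ρ : C5 → ℝ) (p : C5) : C5 →L[ℝ] ℂ :=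
  (1 / 2 : ℂ) • (Complex.ofRealCLM ∘L fderiv ℝ ρ p
    + Complex.I • (Complex.ofRealCLM ∘L (fderiv ℝ ρ p ∘L J)))

/-- The contact form `θ = √-1 ∂̄ρ`. It is real-valued on vectors tangent to `M = {ρ = 0}`, on
which its kernel is the complex tangent space. -/
def theta (ρ : C5 → ℝ) (p : C5) : C5 →L[ℝ] ℂ := Complex.I • dbar ρ p

/-- The value `dη_p (v, w)` of the exterior derivative of a complex-valued `1`-form `η`. -/
def extDerivOne (η : C5 → C5 →L[ℝ] ℂ) (p v w : C5) : ℂ :=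
  extDeriv (fun x => ContinuousAlternatingMap.ofSubsingleton ℝ C5 ℂ (0 : Fin 1) (η x)) p ![v, w]

/-- The value `(η ∧ η̄) (v, w)` for a complex-valued `1`-form `η`. -/
def wedgeConj (η : C5 →L[ℝ] ℂ) (v w : C5) : ℂ := η v * conj (η w) - η w * conj (η v)

/-- `α⁰, α¹, α², α³` (indexed from `0`) are a `T^{1,0*}M` coframe of class `C^n` on `M = {ρ = 0}`
which diagonalises the Levi form:
`dθ ≡ √-1 (α⁰ ∧ ᾱ⁰ + α¹ ∧ ᾱ¹ - α² ∧ ᾱ² - α³ ∧ ᾱ³)  mod θ` on `M`.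
Only the restriction of `α i p` to `T_p M`, for `p` in `M`, matters. A form is of type `(1,0)`,
i.e. it vanishes on `T^{0,1}M`, exactly if it is complex linear on `T^c M`; the congruence modulo
`θ` is equality on `ker θ = T^c M`. -/
structure IsAdaptedCoframe (n : WithTop ℕ∞) (Ω : Set C5) (ρ : C5 → ℝ)
    (α : Fin 4 → C5 → C5 →L[ℝ] ℂ) : Prop where
  contDiffOn : ∀ i, ContDiffOn ℝ n (α i) (hypersurface Ω ρ)
  type_one_zero : ∀ i, ∀ p ∈ hypersurface Ω ρ, ∀ v ∈ complexTangent ρ p,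
    α i p (J v) = Complex.I * α i p v
  independent : ∀ p ∈ hypersurface Ω ρ, ∀ v ∈ complexTangent ρ p,
    (∀ i, α i p v = 0) → v = 0
  levi : ∀ p ∈ hypersurface Ω ρ, ∀ v ∈ complexTangent ρ p, ∀ w ∈ complexTangent ρ p,
    extDerivOne (theta ρ) p v w =
      Complex.I * (wedgeConj (α 0 p) v w + wedgeConj (α 1 p) v w
        - wedgeConj (α 2 p) v w - wedgeConj (α 3 p) v w)

/-! ### Immersions of the bidisk -/

/-- `φ` is an immersion (of real manifolds) of class `C^n` of the bidisk into `M = {ρ = 0}`. -/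
structure IsBidiskImmersion (n : WithTop ℕ∞) (Ω : Set C5) (ρ : C5 → ℝ)
    (φ : ℂ × ℂ → C5) : Prop where
  contDiffOn : ContDiffOn ℝ n φ bidisk
  mapsTo : Set.MapsTo φ bidisk (hypersurface Ω ρ)
  injective_fderiv : ∀ y ∈ bidisk, Function.Injective (fderiv ℝ φ y)

/-- `φ` is a holomorphic immersion of the bidisk into `M = {ρ = 0}`: an immersion such that
every `φ_* T_y 𝔻²` is invariant under `J` and contained in `ker θ`. -/
structure IsHolomorphicImmersion (n : WithTop ℕ∞) (Ω : Set C5) (ρ : C5 → ℝ)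
    (φ : ℂ × ℂ → C5) : Prop extends IsBidiskImmersion n Ω ρ φ where
  J_invariant : ∀ y ∈ bidisk, ∀ w : ℂ × ℂ, ∃ w' : ℂ × ℂ, fderiv ℝ φ y w' = J (fderiv ℝ φ y w)
  theta_eq_zero : ∀ y ∈ bidisk, ∀ w : ℂ × ℂ, theta ρ (φ y) (fderiv ℝ φ y w) = 0

/-- `S` is a (locally closed) complex submanifold of `ℂ⁵` of complex dimension `2`: locally it is
the zero set of a holomorphic submersion to `ℂ³`. -/
def IsComplexSurface (S : Set C5) : Prop :=
  ∀ p ∈ S, ∃ N : Set C5, IsOpen N ∧ p ∈ N ∧ ∃ F : C5 → (Fin 3 → ℂ),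
    DifferentiableOn ℂ F N ∧ (∀ z ∈ N, Function.Surjective (fderiv ℂ F z)) ∧
      S ∩ N = {z | z ∈ N ∧ F z = 0}

/-! ### Lifts to `M × U(2)` and the Pfaffian system -/

/-- `Φ` is a lift of class `C^n` of `φ` to `M × U(2)`: `π ∘ Φ = φ` on the bidisk, where `π` is the
projection to the first factor. -/
structure IsLift (n : WithTop ℕ∞) (Ω : Set C5) (ρ : C5 → ℝ) (φ : ℂ × ℂ → C5)
    (Φ : ℂ × ℂ → C5 × Mat2) : Prop where
  contDiffOn : ContDiffOn ℝ n Φ bidisk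
  mapsTo : Set.MapsTo Φ bidisk
    (hypersurface Ω ρ ×ˢ (Matrix.unitaryGroup (Fin 2) ℂ : Set Mat2))
  proj : ∀ y ∈ bidisk, (Φ y).1 = φ y

/-- Complex-valued `1`-forms on `ℂ⁵ × Mat₂(ℂ)`; they are used at points of `M × U(2)`. -/
abbrev OneForm : Type := C5 × Mat2 → (C5 × Mat2 →L[ℝ] ℂ)

/-- `ω⁰ = θ`. -/
def omega0 (ρ : C5 → ℝ) : OneForm := fun x =>
  theta ρ x.1 ∘L ContinuousLinearMap.fst ℝ C5 Mat2

/-- `ω³ = α³ - P α¹ - Q α²` at `(p, (P, Q; R, S))` (the coframe is indexed from `0` below). -/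
def omega3 (α : Fin 4 → C5 → C5 →L[ℝ] ℂ) : OneForm := fun x =>
  (α 2 x.1 - x.2 0 0 • α 0 x.1 - x.2 0 1 • α 1 x.1) ∘L ContinuousLinearMap.fst ℝ C5 Mat2

/-- `ω⁴ = α⁴ - R α¹ - S α²` at `(p, (P, Q; R, S))` (the coframe is indexed from `0` below). -/
def omega4 (α : Fin 4 → C5 → C5 →L[ℝ] ℂ) : OneForm := fun x =>
  (α 3 x.1 - x.2 1 0 • α 0 x.1 - x.2 1 1 • α 1 x.1) ∘L ContinuousLinearMap.fst ℝ C5 Mat2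

/-- The complex conjugate of a `1`-form. -/
def conjForm (η : OneForm) : OneForm := fun x =>
  (Complex.conjCLE : ℂ →L[ℝ] ℂ) ∘L η x

/-- The pullback `Φ^* η` of a `1`-form, on real tangent vectors of the bidisk. -/
def pullback (Φ : ℂ × ℂ → C5 × Mat2) (η : OneForm) (y : ℂ × ℂ) : ℂ × ℂ →L[ℝ] ℂ :=
  η (Φ y) ∘L fderiv ℝ Φ y

/-- `0 = Φ^* ω⁰ = Φ^* ω³ = Φ^* ω⁴ = Φ^* ω̄³ = Φ^* ω̄⁴` on the bidisk. -/
def IsIntegral (ρ : C5 → ℝ) (α : Fin 4 → C5 → C5 →L[ℝ] ℂ) (Φ : ℂ × ℂ → C5 × Mat2) : Prop :=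
  ∀ y ∈ bidisk,
    pullback Φ (omega0 ρ) y = 0 ∧
    pullback Φ (omega3 α) y = 0 ∧
    pullback Φ (omega4 α) y = 0 ∧
    pullback Φ (conjForm (omega3 α)) y = 0 ∧
    pullback Φ (conjForm (omega4 α)) y = 0

/-- The value `α i (φ_* ∂_e)` on the pushforward of the `(1,0)`-vector
`∂_e = (e - √-1 (√-1 e)) / 2` of the bidisk; `∂_e` is `∂_s` for `e = (1, 0)` and `∂_t` for
`e = (0, 1)`. -/
def coeff (α : Fin 4 → C5 → C5 →L[ℝ] ℂ) (φ : ℂ × ℂ → C5) (i : Fin 4) (e y : ℂ × ℂ) : ℂ :=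
  (α i (φ y) (fderiv ℝ φ y e) - Complex.I * α i (φ y) (fderiv ℝ φ y (Complex.I • e))) / 2

/-- The matrix `(f₁, g₁; f₂, g₂)`, where `φ_* ∂_s = ∑ fᵢ 𝒜ᵢ` and `φ_* ∂_t = ∑ gᵢ 𝒜ᵢ` in the frame
dual to the coframe. -/
def upperMatrix (α : Fin 4 → C5 → C5 →L[ℝ] ℂ) (φ : ℂ × ℂ → C5) (y : ℂ × ℂ) : Mat2 :=
  !![coeff α φ 0 (1, 0) y, coeff α φ 0 (0, 1) y; coeff α φ 1 (1, 0) y, coeff α φ 1 (0, 1) y]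

/-- The matrix `(f₃, g₃; f₄, g₄)`. -/
def lowerMatrix (α : Fin 4 → C5 → C5 →L[ℝ] ℂ) (φ : ℂ × ℂ → C5) (y : ℂ × ℂ) : Mat2 :=
  !![coeff α φ 2 (1, 0) y, coeff α φ 2 (0, 1) y; coeff α φ 3 (1, 0) y, coeff α φ 3 (0, 1) y]

end

end BidiskLift

namespace BidiskLift

/-! Index the coframe from 0. If `φ` is a holomorphic immersion, `θ` pulls back to zero, hence so
does `dθ` (`extDerivOne_theta_eq_zero`). Evaluated on `(v, Jv)` with `v` tangent to the image, the
Levi identity becomes `|α⁰v|² + |α¹v|² = |α²v|² + |α³v|²` (`normSq_pullbackPair`): the tangent space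
is a null plane of a form of signature (2,2). Thus `(α⁰, α¹)` maps it isomorphically onto `ℂ²`, and
it is the graph `(α², α³) = U (α⁰, α¹)` of a complex linear isometry `U`, which is the fibre
component of the lift (`liftMatrix_spec`). Since `ω⁰`, `ω³`, `ω⁴` have no component along `U(2)`,
the system `(*)` is this pointwise linear equation for `U` together with `θ ∘ dφ = 0`
(`isIntegral_iff`); hence uniqueness.

Conversely, the graph of a complex matrix is a complex subspace, so `(*)` forces `J`-invariance. An
immersion with `J`-invariant tangent spaces is, after a real reparametrisation, locally the graph of
a map satisfying the Cauchy–Riemann equations (`exists_local_equation`). -/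

theorem J_apply (v : C5) : J v = Complex.I • v := rfl

/-! ### Immersions with complex tangent spaces. -/

theorem exists_splitting (K : Submodule ℂ C5) (hK : Module.finrank ℂ K = 2) :
    ∃ Θ : C5 ≃L[ℂ] (ℂ × ℂ) × (Fin 3 → ℂ), ∀ v ∈ K, (Θ v).1 = 0 → v = 0 := by
  obtain ⟨K', hc⟩ := K.exists_isCompl
  have hsum := Submodule.finrank_add_eq_of_isCompl hc
  rw [hK, Module.finrank_fin_fun] at hsum
  let a : K ≃ₗ[ℂ] ℂ × ℂ := LinearEquiv.ofFinrankEq _ _ (by simp [hK])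
  let b : K' ≃ₗ[ℂ] (Fin 3 → ℂ) := LinearEquiv.ofFinrankEq _ _ (by simp; omega)
  let e := (Submodule.prodEquivOfIsCompl K K' hc).symm.trans (a.prodCongr b)
  refine ⟨e.toContinuousLinearEquiv, fun v hv h => ?_⟩
  have h1 : (Submodule.prodEquivOfIsCompl K K' hc).symm v = (⟨v, hv⟩, 0) :=
    Submodule.prodEquivOfIsCompl_symm_apply_left _ _ hc ⟨v, hv⟩
  have h2 : a ⟨v, hv⟩ = 0 := by
    have : (e v).1 = a ⟨v, hv⟩ := by simp [e, h1]
    rw [← this]; exact h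
  simpa using h2

theorem complex_smul_eq {E : Type*} [AddCommGroup E] [Module ℂ E] (c : ℂ) (v : E) :
    c • v = c.re • v + c.im • (Complex.I • v) := by
  conv_lhs => rw [← Complex.re_add_im c, add_smul, mul_smul]
  simp

theorem differentiableAt_complex_of_fderiv_I_smul {E F : Type*} [NormedAddCommGroup E]
    [NormedSpace ℂ E] [NormedAddCommGroup F] [NormedSpace ℂ F] {f : E → F} {x : E}
    (hf : DifferentiableAt ℝ f x)
    (hI : ∀ v, fderiv ℝ f x (Complex.I • v) = Complex.I • fderiv ℝ f x v) :
    DifferentiableAt ℂ f x := by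
  refine (differentiableAt_iff_restrictScalars ℝ hf).2 ⟨
    { toFun := fderiv ℝ f x
      map_add' := map_add _
      map_smul' := fun c v => ?_
      cont := (fderiv ℝ f x).continuous }, rfl⟩
  simp only [RingHom.id_apply]
  rw [complex_smul_eq c v, complex_smul_eq c, map_add, map_smul, map_smul, hI]

/-- Near a point, a real immersion whose tangent spaces are `J`-invariant parametrises a
complex submanifold. -/
theorem exists_local_equation {φ : ℂ × ℂ → C5} {W : Set (ℂ × ℂ)} (hW : IsOpen W)
    (hφ : ContDiffOn ℝ 1 φ W) (hinj : ∀ y ∈ W, Function.Injective (fderiv ℝ φ y))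
    (hJ : ∀ y ∈ W, ∀ w, ∃ w', fderiv ℝ φ y w' = J (fderiv ℝ φ y w))
    {y₀ : ℂ × ℂ} (hy₀ : y₀ ∈ W) :
    ∃ V : Set (ℂ × ℂ), IsOpen V ∧ y₀ ∈ V ∧ V ⊆ W ∧ ∃ N : Set C5, IsOpen N ∧ φ '' V ⊆ N ∧
      ∃ F : C5 → (Fin 3 → ℂ), DifferentiableOn ℂ F N ∧
        (∀ z ∈ N, Function.Surjective (fderiv ℂ F z)) ∧ φ '' V = {z | z ∈ N ∧ F z = 0} := by
  let K : Submodule ℂ C5 :=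
    { carrier := Set.range (fderiv ℝ φ y₀)
      zero_mem' := ⟨0, map_zero _⟩
      add_mem' := by
        rintro _ _ ⟨a, rfl⟩ ⟨b, rfl⟩
        exact ⟨a + b, map_add _ _ _⟩
      smul_mem' := by
        rintro c _ ⟨a, rfl⟩
        obtain ⟨a', ha'⟩ := hJ y₀ hy₀ a
        refine ⟨c.re • a + c.im • a', ?_⟩
        rw [map_add, map_smul, map_smul, ha', complex_smul_eq c]
        rfl }
  have hK : Module.finrank ℂ K = 2 := by
    have h1 : Module.finrank ℝ K = Module.finrank ℝ (ℂ × ℂ) :=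
      LinearMap.finrank_range_of_inj (f := (fderiv ℝ φ y₀ : ℂ × ℂ →ₗ[ℝ] C5)) (hinj y₀ hy₀)
    rw [finrank_real_of_complex, finrank_real_of_complex] at h1
    simp at h1
    omega
  obtain ⟨Θ, hΘ⟩ := exists_splitting K hK
  let π : C5 →L[ℂ] ℂ × ℂ := ContinuousLinearMap.fst ℂ _ _ ∘L (Θ : C5 →L[ℂ] (ℂ × ℂ) × (Fin 3 → ℂ))
  let q : C5 →L[ℂ] (Fin 3 → ℂ) := ContinuousLinearMap.snd ℂ _ _ ∘L (Θ : C5 →L[ℂ] (ℂ × ℂ) × (Fin 3 → ℂ))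
  have hΘπ (z : C5) : Θ z = (π z, q z) := rfl
  have hWn := hW.mem_nhds hy₀
  have hφy {y} (hy : y ∈ W) : HasFDerivAt φ (fderiv ℝ φ y) y :=
    ((hφ.contDiffAt (hW.mem_nhds hy)).differentiableAt one_ne_zero).hasFDerivAt
  let πR : C5 →L[ℝ] ℂ × ℂ := π.restrictScalars ℝ
  let A : ℂ × ℂ →L[ℝ] ℂ × ℂ := πR ∘L fderiv ℝ φ y₀
  have hA : Function.Injective A := by
    rw [injective_iff_map_eq_zero]
    intro a ha
    have := hΘ _ (show fderiv ℝ φ y₀ a ∈ K from ⟨a, rfl⟩) ha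
    exact (injective_iff_map_eq_zero _).1 (hinj y₀ hy₀) a this
  -- The projection along a complement of the tangent plane `K` is a local diffeomorphism on the
  -- image, so the inverse function theorem makes the image a graph over `ℂ²`.
  let e : (ℂ × ℂ) ≃L[ℝ] ℂ × ℂ :=
    (LinearEquiv.ofInjectiveEndo (A : ℂ × ℂ →ₗ[ℝ] ℂ × ℂ) hA).toContinuousLinearEquiv
  have hh : ContDiffAt ℝ 1 (fun y => πR (φ y)) y₀ :=
    πR.contDiff.contDiffAt.comp y₀ (hφ.contDiffAt hWn)
  have hhe : HasFDerivAt (fun y => πR (φ y)) (e : ℂ × ℂ →L[ℝ] ℂ × ℂ) y₀ :=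
    πR.hasFDerivAt.comp y₀ (hφy hy₀)
  let H := hh.toOpenPartialHomeomorph _ hhe one_ne_zero
  have hy₀H : y₀ ∈ H.source := hh.mem_toOpenPartialHomeomorph_source hhe one_ne_zero
  have hsymm : ContDiffAt ℝ 1 H.symm (H y₀) := hh.to_localInverse hhe one_ne_zero
  -- Being `C¹` at a point propagates to a neighbourhood because the order is finite.
  obtain ⟨U, hU, hUo, hy₀U⟩ := eventually_nhds_iff.1 (hsymm.eventually (by simp))
  let V : Set (ℂ × ℂ) := (H.source ∩ W) ∩ H ⁻¹' U
  have hVo : IsOpen V :=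
    (H.continuousOn.mono Set.inter_subset_left).isOpen_inter_preimage (H.open_source.inter hW) hUo
  have hVs : V ⊆ H.source := fun y hy => hy.1.1
  have hVW : V ⊆ W := fun y hy => hy.1.2
  have hHVo : IsOpen (H '' V) := H.isOpen_image_of_subset_source hVo hVs
  have hsymmV {u} (hu : u ∈ H '' V) : H.symm u ∈ V ∧ π (φ (H.symm u)) = u := by
    obtain ⟨y, hy, rfl⟩ := hu
    rw [H.left_inv (hVs hy)]
    exact ⟨hy, rfl⟩
  let G : ℂ × ℂ → C5 := fun u => φ (H.symm u)
  have hG {u} (hu : u ∈ H '' V) : DifferentiableAt ℂ G u := by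
    have huV := hsymmV hu
    have hψ : HasFDerivAt H.symm (fderiv ℝ H.symm u) u := by
      obtain ⟨y, hy, rfl⟩ := hu
      exact ((hU _ hy.2).differentiableAt one_ne_zero).hasFDerivAt
    set B := fderiv ℝ H.symm u
    have hGd : HasFDerivAt G (fderiv ℝ φ (H.symm u) ∘L B) u := (hφy (hVW huV.1)).comp u hψ
    have hid : πR ∘L (fderiv ℝ φ (H.symm u) ∘L B) = ContinuousLinearMap.id ℝ _ := by
      refine (πR.hasFDerivAt.comp u hGd).unique ((hasFDerivAt_id u).congr_of_eventuallyEq ?_)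
      filter_upwards [hHVo.mem_nhds hu] with x hx using (hsymmV hx).2
    have hid' (k) : π (fderiv ℝ φ (H.symm u) (B k)) = k :=
      congrArg (fun T : ℂ × ℂ →L[ℝ] ℂ × ℂ => T k) hid
    have hBs : Function.Surjective B := by
      refine LinearMap.injective_iff_surjective (f := (B : ℂ × ℂ →ₗ[ℝ] ℂ × ℂ)).1 ?_
      intro k k' hkk
      rw [← hid' k, ← hid' k']
      exact congrArg (fun x => π (fderiv ℝ φ (H.symm u) x)) hkk
    -- Cauchy–Riemann: `J (dG k)` is tangent to the image, hence equals some `dG k'`; applying `π`,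
    -- a left inverse of `dG`, gives `k' = i k`.
    refine differentiableAt_complex_of_fderiv_I_smul hGd.differentiableAt fun k => ?_
    rw [hGd.fderiv]
    obtain ⟨w', hw'⟩ := hJ _ (hVW huV.1) (B k)
    obtain ⟨k', rfl⟩ := hBs w'
    have hk' : k' = Complex.I • k := by
      rw [← hid' k', hw']
      rw [J_apply, map_smul, hid']
    rw [← hk']
    exact hw'
  let N : Set C5 := π ⁻¹' (H '' V)
  -- The equation of the graph of `q ∘ G` in the coordinates `Θ = (π, q)`.
  let F : C5 → Fin 3 → ℂ := fun z => q z - q (G (π z))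
  have hFd {z} (hz : z ∈ N) : HasFDerivAt F (q - q ∘L (fderiv ℂ G (π z) ∘L π)) z :=
    q.hasFDerivAt.sub (q.hasFDerivAt.comp z ((hG hz).hasFDerivAt.comp z π.hasFDerivAt))
  refine ⟨V, hVo, ⟨⟨hy₀H, hy₀⟩, hy₀U⟩, hVW, N, hHVo.preimage π.continuous, ?_, F,
    fun z hz => (hFd hz).differentiableAt.differentiableWithinAt, fun z hz => ?_, ?_⟩
  · rintro _ ⟨y, hy, rfl⟩
    exact ⟨y, hy, rfl⟩
  · rw [(hFd hz).fderiv]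
    intro c
    refine ⟨Θ.symm (0, c), ?_⟩
    have h1 : Θ (Θ.symm (0, c)) = (0, c) := Θ.apply_symm_apply _
    rw [hΘπ, Prod.mk.injEq] at h1
    simp [h1.1, h1.2]
  · ext z
    constructor
    · rintro ⟨y, hy, rfl⟩
      refine ⟨⟨y, hy, rfl⟩, ?_⟩
      change q (φ y) - q (φ (H.symm (H y))) = 0
      rw [H.left_inv (hVs hy), sub_self]
    · rintro ⟨hz, hFz⟩
      have := hsymmV hz
      refine ⟨H.symm (π z), this.1, Θ.injective ?_⟩
      rw [hΘπ, hΘπ, this.2, ← sub_eq_zero.1 hFz]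

theorem isComplexSurface_of_equation {S N : Set C5} (hN : IsOpen N) (hSN : S ⊆ N)
    {F : C5 → (Fin 3 → ℂ)} (hF : DifferentiableOn ℂ F N)
    (hs : ∀ z ∈ N, Function.Surjective (fderiv ℂ F z)) (hS : S = {z | z ∈ N ∧ F z = 0}) :
    IsComplexSurface S := fun p hp =>
  ⟨N, hN, hSN hp, F, hF, hs, by rw [Set.inter_eq_left.2 hSN]; exact hS⟩

/-- An embedding lets the ambient neighbourhood shrink until no other sheet of the image enters it.
-/
theorem isComplexSurface_image_of_isEmbedding {φ : ℂ × ℂ → C5} {W : Set (ℂ × ℂ)} (hW : IsOpen W)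
    (hφ : ContDiffOn ℝ 1 φ W) (hinj : ∀ y ∈ W, Function.Injective (fderiv ℝ φ y))
    (hJ : ∀ y ∈ W, ∀ w, ∃ w', fderiv ℝ φ y w' = J (fderiv ℝ φ y w))
    (hemb : Topology.IsEmbedding (W.domRestrict φ)) : IsComplexSurface (φ '' W) := by
  rintro _ ⟨y, hy, rfl⟩
  obtain ⟨V, hVo, hyV, hVW, N, hN, hVN, F, hF, hs, hS⟩ :=
    exists_local_equation hW hφ hinj hJ hy
  obtain ⟨O, hO, hOV⟩ := hemb.isInducing.isOpen_iff.1 (hVo.preimage continuous_subtype_val)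
  have hmem {x} (hx : x ∈ W) : φ x ∈ O ↔ x ∈ V := by
    have := Set.ext_iff.1 hOV ⟨x, hx⟩
    exact this
  refine ⟨N ∩ O, hN.inter hO, ⟨hVN ⟨y, hyV, rfl⟩, (hmem hy).2 hyV⟩, F,
    hF.mono Set.inter_subset_left, fun z hz => hs z hz.1, ?_⟩
  ext z
  constructor
  · rintro ⟨⟨x, hx, rfl⟩, hxN, hxO⟩
    have : φ x ∈ φ '' V := ⟨x, (hmem hx).1 hxO, rfl⟩
    rw [hS] at this
    exact ⟨⟨hxN, hxO⟩, this.2⟩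
  · rintro ⟨hz, hFz⟩
    have : z ∈ φ '' V := by rw [hS]; exact ⟨hz.1, hFz⟩
    exact ⟨Set.image_mono hVW this, hz⟩

/-! ### The contact form along the immersion. -/

theorem isOpen_bidisk : IsOpen bidisk := Metric.isOpen_ball.prod Metric.isOpen_ball

theorem one_add_one_le {n : WithTop ℕ∞} (hn : ∞ ≤ n) : (1 : WithTop ℕ∞) + 1 ≤ n := by
  refine le_trans ?_ hn
  rw [one_add_one_eq_two]
  exact WithTop.coe_le_coe.2 (le_top : (2 : ℕ∞) ≤ ⊤)

theorem theta_apply (ρ : C5 → ℝ) (p v : C5) :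
    theta ρ p v = Complex.I * (1 / 2 * (fderiv ℝ ρ p v + Complex.I * fderiv ℝ ρ p (J v))) := rfl

theorem theta_apply_eq_zero_iff {ρ : C5 → ℝ} {p v : C5} :
    theta ρ p v = 0 ↔ v ∈ complexTangent ρ p := by
  simp [theta_apply, complexTangent, Complex.ext_iff]

theorem complexTangent_J {ρ : C5 → ℝ} {p v : C5} (hv : v ∈ complexTangent ρ p) :
    J v ∈ complexTangent ρ p := by
  refine ⟨hv.2, ?_⟩
  have : J (J v) = -v := by simp [J_apply, smul_smul]
  rw [this, map_neg, hv.1, neg_zero]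

theorem complexTangent_sub {ρ : C5 → ℝ} {p v w : C5} (hv : v ∈ complexTangent ρ p)
    (hw : w ∈ complexTangent ρ p) : v - w ∈ complexTangent ρ p := by
  constructor
  · rw [map_sub, hv.1, hw.1, sub_zero]
  · rw [map_sub, map_sub, hv.2, hw.2, sub_zero]

theorem hasFDerivAt_clm_apply_const {E F G : Type*} [NormedAddCommGroup E] [NormedSpace ℝ E]
    [NormedAddCommGroup F] [NormedSpace ℝ F] [NormedAddCommGroup G] [NormedSpace ℝ G]
    {c : E → F →L[ℝ] G} {c' : E →L[ℝ] F →L[ℝ] G} {x : E} (hc : HasFDerivAt c c' x) (u : F) :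
    HasFDerivAt (fun y => c y u) (c'.flip u) x :=
  (ContinuousLinearMap.apply ℝ G u).hasFDerivAt.comp x hc

theorem extDerivOne_apply {η : C5 → C5 →L[ℝ] ℂ} {p : C5} (hη : DifferentiableAt ℝ η p)
    (v w : C5) : extDerivOne η p v w = fderiv ℝ η p v w - fderiv ℝ η p w v := by
  have hd : DifferentiableAt ℝ
      (fun x => ContinuousAlternatingMap.ofSubsingleton ℝ C5 ℂ (0 : Fin 1) (η x)) p :=
    (ContinuousAlternatingMap.ofSubsingletonLIE (𝕜 := ℝ) (E := C5) (F := ℂ)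
      (0 : Fin 1)).differentiableAt.comp p hη
  have hf (u : C5) : HasFDerivAt (fun x => η x u) ((fderiv ℝ η p).flip u) p :=
    hasFDerivAt_clm_apply_const hη.hasFDerivAt u
  rw [extDerivOne, extDeriv_apply hd, Fin.sum_univ_two]
  simp [Fin.removeNth, (hf _).fderiv, sub_eq_add_neg]

theorem differentiableAt_theta {n : WithTop ℕ∞} (hn : ∞ ≤ n) {Ω : Set C5} {ρ : C5 → ℝ}
    (hρ : IsDefiningFunction n Ω ρ) {p : C5} (hp : p ∈ Ω) : DifferentiableAt ℝ (theta ρ) p := by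
  have h2 : (1 : WithTop ℕ∞) + 1 ≤ n := one_add_one_le hn
  have hd : DifferentiableAt ℝ (fderiv ℝ ρ) p :=
    ((hρ.contDiffOn.fderiv_of_isOpen hρ.isOpen h2).differentiableOn one_ne_zero).differentiableAt
      (hρ.isOpen.mem_nhds hp)
  have hc : DifferentiableAt ℝ (fun x => Complex.ofRealCLM ∘L fderiv ℝ ρ x) p :=
    (differentiableAt_const _).clm_comp hd
  have hJ : DifferentiableAt ℝ (fun x => Complex.ofRealCLM ∘L (fderiv ℝ ρ x ∘L J)) p :=
    (differentiableAt_const _).clm_comp (hd.clm_comp (differentiableAt_const _))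
  exact ((hc.add (hJ.const_smul Complex.I)).const_smul (1 / 2 : ℂ)).const_smul Complex.I

/-- If `θ` pulls back to zero, then so does `dθ`. -/
theorem extDerivOne_theta_eq_zero {n : WithTop ℕ∞} (hn : ∞ ≤ n) {Ω : Set C5} {ρ : C5 → ℝ}
    (hρ : IsDefiningFunction n Ω ρ) {φ : ℂ × ℂ → C5} (hφ : IsBidiskImmersion n Ω ρ φ)
    (hθ : ∀ y ∈ bidisk, ∀ w, theta ρ (φ y) (fderiv ℝ φ y w) = 0) {y : ℂ × ℂ} (hy : y ∈ bidisk)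
    (e f : ℂ × ℂ) :
    extDerivOne (theta ρ) (φ y) (fderiv ℝ φ y e) (fderiv ℝ φ y f) = 0 := by
  have h2 : (1 : WithTop ℕ∞) + 1 ≤ n := one_add_one_le hn
  have hyn := isOpen_bidisk.mem_nhds hy
  have hφy := hφ.contDiffOn.contDiffAt hyn
  have hsymm : IsSymmSndFDerivAt ℝ φ y := hφy.isSymmSndFDerivAt (by
    rw [minSmoothness_of_isRCLikeNormedField]; exact (by norm_num : (2 : WithTop ℕ∞) ≤ 1 + 1).trans h2)
  have hdφ : HasFDerivAt φ (fderiv ℝ φ y) y :=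
    (hφy.differentiableAt (fun h => by simp [h] at hn)).hasFDerivAt
  have hd2 : HasFDerivAt (fderiv ℝ φ) (fderiv ℝ (fderiv ℝ φ) y) y :=
    (((hφ.contDiffOn.fderiv_of_isOpen isOpen_bidisk h2).differentiableOn
      one_ne_zero).differentiableAt hyn).hasFDerivAt
  have hθd := differentiableAt_theta hn hρ (hφ.mapsTo hy).1
  -- Differentiate `θ (dφ b) = 0` in the direction `a`. Antisymmetrising in `a, b` cancels the
  -- second derivatives of `φ` and leaves `dθ`.
  have key (a b : ℂ × ℂ) : fderiv ℝ (theta ρ) (φ y) (fderiv ℝ φ y a) (fderiv ℝ φ y b)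
      + theta ρ (φ y) (fderiv ℝ (fderiv ℝ φ) y a b) = 0 := by
    have h1 := (hθd.hasFDerivAt.comp y hdφ).clm_apply (hasFDerivAt_clm_apply_const hd2 b)
    have h0 : HasFDerivAt (fun x => theta ρ (φ x) (fderiv ℝ φ x b)) (0 : ℂ × ℂ →L[ℝ] ℂ) y :=
      (hasFDerivAt_const (0 : ℂ) y).congr_of_eventuallyEq
        (by filter_upwards [hyn] with x hx using hθ x hx b)
    have := congrArg (fun T : ℂ × ℂ →L[ℝ] ℂ => T a) (h1.unique h0)
    simpa [add_comm] using this
  rw [extDerivOne_apply hθd, ← sub_eq_zero.2 ((key e f).trans (key f e).symm),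
    hsymm.eq e f]
  ring

/-! ### Null planes of the Levi form and the unitary matrix. -/

/-- The pair `(φ^* αⁱ, φ^* αʲ)` at `y`, as a real linear map to `ℂ²`. -/
noncomputable def pullbackPair (α : Fin 4 → C5 → C5 →L[ℝ] ℂ) (φ : ℂ × ℂ → C5) (i j : Fin 4)
    (y : ℂ × ℂ) : ℂ × ℂ →L[ℝ] (Fin 2 → ℂ) :=
  ContinuousLinearMap.pi ![α i (φ y) ∘L fderiv ℝ φ y, α j (φ y) ∘L fderiv ℝ φ y]

/-- The matrix `U` determined by `(α³, α⁴) = U (α¹, α²)` on the image of `dφ_y`. -/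
noncomputable def liftMatrix (α : Fin 4 → C5 → C5 →L[ℝ] ℂ) (φ : ℂ × ℂ → C5) (y : ℂ × ℂ) : Mat2 :=
  Matrix.of fun i j =>
    pullbackPair α φ 2 3 y ((pullbackPair α φ 0 1 y).inverse (Pi.single j 1)) i

section

variable {n : WithTop ℕ∞} {Ω : Set C5} {ρ : C5 → ℝ} {α : Fin 4 → C5 → C5 →L[ℝ] ℂ}
  {φ : ℂ × ℂ → C5} {y : ℂ × ℂ}

@[simp] theorem pullbackPair_apply_zero (i j : Fin 4) (e : ℂ × ℂ) :
    pullbackPair α φ i j y e 0 = α i (φ y) (fderiv ℝ φ y e) := rfl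

@[simp] theorem pullbackPair_apply_one (i j : Fin 4) (e : ℂ × ℂ) :
    pullbackPair α φ i j y e 1 = α j (φ y) (fderiv ℝ φ y e) := rfl

theorem contDiffOn_pullbackPair (hn : ∞ ≤ n) (hα : IsAdaptedCoframe n Ω ρ α)
    (hφ : IsBidiskImmersion n Ω ρ φ) (i j : Fin 4) :
    ContDiffOn ℝ n (pullbackPair α φ i j) bidisk := by
  -- The order is `∞` or `ω`, so differentiating `φ` loses no regularity.
  have hn1 : n + 1 ≤ n := by
    induction n using WithTop.recTopCoe with
    | top => exact le_top
    | coe m =>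
      obtain rfl : m = ⊤ := top_le_iff.1 (WithTop.coe_le_coe.1 hn)
      exact le_rfl
  have hd := hφ.contDiffOn.fderiv_of_isOpen isOpen_bidisk hn1
  have hk (k : Fin 4) (e : ℂ × ℂ) :
      ContDiffOn ℝ n (fun y => α k (φ y) (fderiv ℝ φ y e)) bidisk :=
    ((hα.contDiffOn k).comp hφ.contDiffOn hφ.mapsTo).clm_apply
      (hd.clm_apply contDiffOn_const)
  refine contDiffOn_clm_apply.2 fun e => contDiffOn_pi.2 fun k => ?_
  fin_cases k
  · exact hk i e
  · exact hk j e

/-- The four forms have no common zero on `T^cM`; `hker` reduces them to the first two. -/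
theorem pullbackPair_injective (hα : IsAdaptedCoframe n Ω ρ α) (hφ : IsBidiskImmersion n Ω ρ φ)
    (hy : y ∈ bidisk) (hθ : ∀ e, theta ρ (φ y) (fderiv ℝ φ y e) = 0)
    (hker : ∀ e, pullbackPair α φ 0 1 y e = 0 → pullbackPair α φ 2 3 y e = 0) :
    Function.Injective (pullbackPair α φ 0 1 y) := by
  rw [injective_iff_map_eq_zero]
  intro e he
  have he' := hker e he
  refine (injective_iff_map_eq_zero _).1 (hφ.injective_fderiv y hy) e
    (hα.independent _ (hφ.mapsTo hy) _ (theta_apply_eq_zero_iff.1 (hθ e)) fun i => ?_)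
  fin_cases i
  · exact congrFun he 0
  · exact congrFun he 1
  · exact congrFun he' 0
  · exact congrFun he' 1

theorem exists_equiv_of_injective {T : ℂ × ℂ →L[ℝ] (Fin 2 → ℂ)} (hT : Function.Injective T) :
    ∃ e : (ℂ × ℂ) ≃L[ℝ] (Fin 2 → ℂ), (e : ℂ × ℂ →L[ℝ] (Fin 2 → ℂ)) = T := by
  have hd : Module.finrank ℝ (ℂ × ℂ) = Module.finrank ℝ (Fin 2 → ℂ) := by
    simp [finrank_real_of_complex]
  exact ⟨(LinearMap.linearEquivOfInjective (T : ℂ × ℂ →ₗ[ℝ] (Fin 2 → ℂ)) hT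
    hd).toContinuousLinearEquiv, rfl⟩

theorem pullbackPair_of_J (hα : IsAdaptedCoframe n Ω ρ α) (hφ : IsBidiskImmersion n Ω ρ φ)
    (hy : y ∈ bidisk) (hθ : ∀ e, theta ρ (φ y) (fderiv ℝ φ y e) = 0) {e e' : ℂ × ℂ}
    (he : fderiv ℝ φ y e' = J (fderiv ℝ φ y e)) (i j : Fin 4) :
    pullbackPair α φ i j y e' = Complex.I • pullbackPair α φ i j y e := by
  have h (k : Fin 4) := hα.type_one_zero k _ (hφ.mapsTo hy) _ (theta_apply_eq_zero_iff.1 (hθ e))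
  ext k
  fin_cases k
  · simp [he, h]
  · simp [he, h]

theorem wedgeConj_J {η : C5 →L[ℝ] ℂ} {v : C5} (h : η (J v) = Complex.I * η v) :
    wedgeConj η v (J v) = -2 * Complex.I * Complex.normSq (η v) := by
  rw [wedgeConj, h, ← Complex.mul_conj]
  simp
  ring

/-- The Levi form vanishes on the tangent spaces of a holomorphic immersion. -/
theorem normSq_pullbackPair (hn : ∞ ≤ n) (hρ : IsDefiningFunction n Ω ρ)
    (hα : IsAdaptedCoframe n Ω ρ α) (hφ : IsHolomorphicImmersion n Ω ρ φ) (hy : y ∈ bidisk)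
    (e : ℂ × ℂ) :
    Complex.normSq (pullbackPair α φ 2 3 y e 0) + Complex.normSq (pullbackPair α φ 2 3 y e 1) =
      Complex.normSq (pullbackPair α φ 0 1 y e 0)
        + Complex.normSq (pullbackPair α φ 0 1 y e 1) := by
  obtain ⟨e', he'⟩ := hφ.J_invariant y hy e
  have hp := hφ.mapsTo hy
  have hv := theta_apply_eq_zero_iff.1 (hφ.theta_eq_zero y hy e)
  have h0 := extDerivOne_theta_eq_zero hn hρ hφ.toIsBidiskImmersion hφ.theta_eq_zero hy e e'
  have hw (k : Fin 4) := wedgeConj_J (hα.type_one_zero k _ hp _ hv)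
  rw [he', hα.levi _ hp _ hv _ (complexTangent_J hv), hw, hw, hw, hw] at h0
  simp only [pullbackPair_apply_zero, pullbackPair_apply_one]
  have h1 : ((Complex.normSq (α 2 (φ y) (fderiv ℝ φ y e))
      + Complex.normSq (α 3 (φ y) (fderiv ℝ φ y e)) : ℝ) : ℂ) =
      ((Complex.normSq (α 0 (φ y) (fderiv ℝ φ y e))
      + Complex.normSq (α 1 (φ y) (fderiv ℝ φ y e)) : ℝ) : ℂ) := by
    push_cast
    linear_combination (-1 / 2) * h0 - (Complex.normSq (α 0 (φ y) (fderiv ℝ φ y e))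
      + Complex.normSq (α 1 (φ y) (fderiv ℝ φ y e)) - Complex.normSq (α 2 (φ y) (fderiv ℝ φ y e))
      - Complex.normSq (α 3 (φ y) (fderiv ℝ φ y e)) : ℂ) * Complex.I_sq
  exact_mod_cast h1

/-- Polarisation: the test vectors `e₁`, `e₂`, `e₁ + e₂`, `e₁ + i e₂` determine all entries of `U*
U`. -/
theorem mem_unitaryGroup_of_normSq {U : Mat2}
    (hU : ∀ z : Fin 2 → ℂ, Complex.normSq ((U *ᵥ z) 0) + Complex.normSq ((U *ᵥ z) 1) =
      Complex.normSq (z 0) + Complex.normSq (z 1)) : U ∈ Matrix.unitaryGroup (Fin 2) ℂ := by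
  rw [Matrix.mem_unitaryGroup_iff']
  have h1 := hU ![1, 0]
  have h2 := hU ![0, 1]
  have h3 := hU ![1, 1]
  have h4 := hU ![1, Complex.I]
  simp [Matrix.mulVec, dotProduct, Fin.sum_univ_two, Complex.normSq_apply] at h1 h2 h3 h4
  ext i j
  fin_cases i <;> fin_cases j <;>
    simp [Matrix.mul_apply, Fin.sum_univ_two, Complex.ext_iff] <;> constructor <;> linarith

theorem injective_upper (hn : ∞ ≤ n) (hρ : IsDefiningFunction n Ω ρ)
    (hα : IsAdaptedCoframe n Ω ρ α) (hφ : IsHolomorphicImmersion n Ω ρ φ) (hy : y ∈ bidisk) :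
    Function.Injective (pullbackPair α φ 0 1 y) := by
  refine pullbackPair_injective hα hφ.toIsBidiskImmersion hy (hφ.theta_eq_zero y hy)
    fun e he => ?_
  have h := normSq_pullbackPair hn hρ hα hφ hy e
  rw [he, Pi.zero_apply, Pi.zero_apply, map_zero, add_zero] at h
  have h0 := Complex.normSq_nonneg (pullbackPair α φ 2 3 y e 0)
  have h1 := Complex.normSq_nonneg (pullbackPair α φ 2 3 y e 1)
  ext k
  fin_cases k
  · exact Complex.normSq_eq_zero.1 ((add_eq_zero_iff_of_nonneg h0 h1).1 h).1
  · exact Complex.normSq_eq_zero.1 ((add_eq_zero_iff_of_nonneg h0 h1).1 h).2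

theorem liftMatrix_spec (hn : ∞ ≤ n) (hρ : IsDefiningFunction n Ω ρ)
    (hα : IsAdaptedCoframe n Ω ρ α) (hφ : IsHolomorphicImmersion n Ω ρ φ) (hy : y ∈ bidisk) :
    liftMatrix α φ y ∈ Matrix.unitaryGroup (Fin 2) ℂ ∧
      ∀ e, liftMatrix α φ y *ᵥ pullbackPair α φ 0 1 y e = pullbackPair α φ 2 3 y e := by
  obtain ⟨A, hA⟩ := exists_equiv_of_injective (injective_upper hn hρ hα hφ hy)
  have hAe (e) : pullbackPair α φ 0 1 y e = A e := by rw [← hA]; rfl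
  set B := pullbackPair α φ 2 3 y with hB
  -- `φ` need not be holomorphic, so neither `A` nor `B` need be complex linear; but both carry the
  -- `J`-structure pulled back by `dφ` to multiplication by `i`, so `B ∘ A⁻¹` is.
  have hI (z : Fin 2 → ℂ) : B (A.symm (Complex.I • z)) = Complex.I • B (A.symm z) := by
    obtain ⟨e', he'⟩ := hφ.J_invariant y hy (A.symm z)
    have h (i j) := pullbackPair_of_J hα hφ.toIsBidiskImmersion hy (hφ.theta_eq_zero y hy) he' i j
    rw [← h 2 3, ← hB]
    have h01 := h 0 1
    rw [hAe, hAe, A.apply_symm_apply] at h01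
    rw [← h01, A.symm_apply_apply]
  let T : (Fin 2 → ℂ) →ₗ[ℂ] (Fin 2 → ℂ) :=
    { toFun := fun z => B (A.symm z)
      map_add' := fun z w => by rw [map_add, map_add]
      map_smul' := fun c z => by
        rw [complex_smul_eq c z, map_add, map_add, map_smul, map_smul, map_smul, map_smul, hI,
          RingHom.id_apply, complex_smul_eq c] }
  have hU : liftMatrix α φ y = LinearMap.toMatrix' T := by
    ext i j
    rw [LinearMap.toMatrix'_apply, liftMatrix, ← hA, ContinuousLinearMap.inverse_equiv]
    rfl
  have hUz (z) : liftMatrix α φ y *ᵥ z = B (A.symm z) := by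
    rw [hU, LinearMap.toMatrix'_mulVec]; rfl
  refine ⟨mem_unitaryGroup_of_normSq fun z => ?_, fun e => ?_⟩
  · rw [hUz, normSq_pullbackPair hn hρ hα hφ hy, hAe, A.apply_symm_apply]
  · rw [hUz, hAe, A.symm_apply_apply]

theorem contDiffOn_liftMatrix (hn : ∞ ≤ n) (hρ : IsDefiningFunction n Ω ρ)
    (hα : IsAdaptedCoframe n Ω ρ α) (hφ : IsHolomorphicImmersion n Ω ρ φ) :
    ContDiffOn ℝ n (liftMatrix α φ) bidisk := by
  have hinv : ContDiffOn ℝ n (fun y => (pullbackPair α φ 0 1 y).inverse) bidisk := by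
    intro y hy
    obtain ⟨A, hA⟩ := exists_equiv_of_injective (injective_upper hn hρ hα hφ hy)
    -- Operator inversion is `C^n` at an invertible map for every `n`, the analytic case included.
    have h := contDiffAt_map_inverse (n := n) A
    rw [hA] at h
    exact h.comp_contDiffWithinAt y
      (contDiffOn_pullbackPair hn hα hφ.toIsBidiskImmersion 0 1 y hy)
  refine contDiffOn_pi.2 fun i => contDiffOn_pi.2 fun j => ?_
  exact contDiffOn_pi.1 ((contDiffOn_pullbackPair hn hα hφ.toIsBidiskImmersion 2 3).clm_apply
    (hinv.clm_apply contDiffOn_const)) i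

/-! ### The Pfaffian system as a pointwise equation. -/

theorem isIntegral_iff (hn : ∞ ≤ n) {Φ : ℂ × ℂ → C5 × Mat2} (hΦ : IsLift n Ω ρ φ Φ) :
    IsIntegral ρ α Φ ↔ ∀ y ∈ bidisk, ∀ e, theta ρ (φ y) (fderiv ℝ φ y e) = 0 ∧
      (Φ y).2 *ᵥ pullbackPair α φ 0 1 y e = pullbackPair α φ 2 3 y e := by
  refine forall₂_congr fun y hy => ?_
  have hyn := isOpen_bidisk.mem_nhds hy
  have hΦd : DifferentiableAt ℝ Φ y :=
    (hΦ.contDiffOn.contDiffAt hyn).differentiableAt (fun h => by simp [h] at hn)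
  have hfst : HasFDerivAt φ (ContinuousLinearMap.fst ℝ C5 Mat2 ∘L fderiv ℝ Φ y) y :=
    hΦd.hasFDerivAt.fst.congr_of_eventuallyEq
      (by filter_upwards [hyn] with x hx using (hΦ.proj x hx).symm)
  have hd (e) : (fderiv ℝ Φ y e).1 = fderiv ℝ φ y e := by rw [hfst.fderiv]; rfl
  have hp := hΦ.proj y hy
  have h0 (e) : pullback Φ (omega0 ρ) y e = theta ρ (φ y) (fderiv ℝ φ y e) := by
    rw [← hd, ← hp]; rfl
  have h3 (e) : pullback Φ (omega3 α) y e = pullbackPair α φ 2 3 y e 0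
      - ((Φ y).2 *ᵥ pullbackPair α φ 0 1 y e) 0 := by
    simp only [Matrix.mulVec, dotProduct, Fin.sum_univ_two, pullbackPair_apply_zero,
      pullbackPair_apply_one]
    rw [← hd, ← hp, ← sub_sub]
    rfl
  have h4 (e) : pullback Φ (omega4 α) y e = pullbackPair α φ 2 3 y e 1
      - ((Φ y).2 *ᵥ pullbackPair α φ 0 1 y e) 1 := by
    simp only [Matrix.mulVec, dotProduct, Fin.sum_univ_two, pullbackPair_apply_zero,
      pullbackPair_apply_one]
    rw [← hd, ← hp, ← sub_sub]
    rfl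
  constructor
  · rintro ⟨k0, k3, k4, -, -⟩ e
    refine ⟨by rw [← h0, k0]; rfl, ?_⟩
    ext k
    fin_cases k
    · exact (sub_eq_zero.1 ((h3 e).symm.trans (by rw [k3]; rfl))).symm
    · exact (sub_eq_zero.1 ((h4 e).symm.trans (by rw [k4]; rfl))).symm
  · intro h
    have k3 : pullback Φ (omega3 α) y = 0 := by
      refine ContinuousLinearMap.ext fun e => ?_
      rw [h3, (h e).2, sub_self]; rfl
    have k4 : pullback Φ (omega4 α) y = 0 := by
      refine ContinuousLinearMap.ext fun e => ?_
      rw [h4, (h e).2, sub_self]; rfl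
    have hconj (η : OneForm) (hη : pullback Φ η y = 0) : pullback Φ (conjForm η) y = 0 := by
      refine ContinuousLinearMap.ext fun e => ?_
      exact (congrArg (fun T : ℂ × ℂ →L[ℝ] ℂ => conj (T e)) hη).trans (map_zero _)
    refine ⟨?_, k3, k4, hconj _ k3, hconj _ k4⟩
    refine ContinuousLinearMap.ext fun e => ?_
    rw [h0, (h e).1]; rfl

/-- The preimage of `J (dφ w)` is found by solving for `(α⁰, α¹)`; `(α², α³)` then agree because `U`
commutes with `i`, and the coframe separates vectors of `T^cM`. -/
theorem isHolomorphicImmersion_of_isIntegral (hn : ∞ ≤ n) (hα : IsAdaptedCoframe n Ω ρ α)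
    (hφ : IsBidiskImmersion n Ω ρ φ) {Φ : ℂ × ℂ → C5 × Mat2} (hΦ : IsLift n Ω ρ φ Φ)
    (hI : IsIntegral ρ α Φ) : IsHolomorphicImmersion n Ω ρ φ := by
  rw [isIntegral_iff hn hΦ] at hI
  refine ⟨hφ, fun y hy w => ?_, fun y hy w => (hI y hy w).1⟩
  have hθ := fun e => (hI y hy e).1
  have hlow := fun e => (hI y hy e).2
  obtain ⟨A, hA⟩ := exists_equiv_of_injective (pullbackPair_injective hα hφ hy hθ
    fun e he => by rw [← hlow, he, Matrix.mulVec_zero])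
  have hw' : pullbackPair α φ 0 1 y (A.symm (Complex.I • pullbackPair α φ 0 1 y w)) =
      Complex.I • pullbackPair α φ 0 1 y w := by
    rw [← hA]
    exact A.apply_symm_apply _
  set w' := A.symm (Complex.I • pullbackPair α φ 0 1 y w)
  have hlow' : pullbackPair α φ 2 3 y w' = Complex.I • pullbackPair α φ 2 3 y w := by
    rw [← hlow, hw', Matrix.mulVec_smul, hlow]
  have hT (e) := theta_apply_eq_zero_iff.1 (hθ e)
  refine ⟨w', sub_eq_zero.1 (hα.independent _ (hφ.mapsTo hy) _
    (complexTangent_sub (hT w') (complexTangent_J (hT w))) fun i => ?_)⟩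
  rw [map_sub, hα.type_one_zero i _ (hφ.mapsTo hy) _ (hT w), sub_eq_zero]
  fin_cases i
  · exact congrFun hw' 0
  · exact congrFun hw' 1
  · exact congrFun hlow' 0
  · exact congrFun hlow' 1

/-! ### The explicit formula for holomorphic maps. -/

theorem fderiv_I_smul_eq_J (hd : DifferentiableAt ℂ φ y) (e : ℂ × ℂ) :
    fderiv ℝ φ y (Complex.I • e) = J (fderiv ℝ φ y e) := by
  rw [hd.fderiv_restrictScalars ℝ, J_apply]
  exact map_smul (fderiv ℂ φ y) Complex.I e

theorem coeff_of_differentiableAt (hα : IsAdaptedCoframe n Ω ρ α)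
    (hφ : IsHolomorphicImmersion n Ω ρ φ) (hy : y ∈ bidisk) (hd : DifferentiableAt ℂ φ y)
    (i : Fin 4) (e : ℂ × ℂ) : coeff α φ i e y = α i (φ y) (fderiv ℝ φ y e) := by
  have hJ := fderiv_I_smul_eq_J hd e
  rw [coeff, hJ, hα.type_one_zero i _ (hφ.mapsTo hy) _
    (theta_apply_eq_zero_iff.1 (hφ.theta_eq_zero y hy e)), ← mul_assoc, Complex.I_mul_I]
  ring

/-- Now `(α⁰, α¹) ∘ dφ` is complex linear with matrix `upperMatrix`, so its injectivity is
invertibility; evaluating the graph equation on the two basis vectors gives `U * upper = lower` by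
columns. -/
theorem liftMatrix_eq (hn : ∞ ≤ n) (hρ : IsDefiningFunction n Ω ρ)
    (hα : IsAdaptedCoframe n Ω ρ α) (hφ : IsHolomorphicImmersion n Ω ρ φ) (hy : y ∈ bidisk)
    (hd : DifferentiableAt ℂ φ y) :
    IsUnit (upperMatrix α φ y).det ∧
      liftMatrix α φ y = lowerMatrix α φ y * (upperMatrix α φ y)⁻¹ := by
  have hc := coeff_of_differentiableAt hα hφ hy hd
  have hup (z : Fin 2 → ℂ) : upperMatrix α φ y *ᵥ z = pullbackPair α φ 0 1 y (z 0, z 1) := by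
    have hz : ((z 0, z 1) : ℂ × ℂ) = z 0 • ((1, 0) : ℂ × ℂ) + z 1 • ((0, 1) : ℂ × ℂ) := by simp
    have hlin (c : ℂ) (e : ℂ × ℂ) :
        pullbackPair α φ 0 1 y (c • e) = c • pullbackPair α φ 0 1 y e := by
      have hJ := fderiv_I_smul_eq_J hd e
      rw [complex_smul_eq c e, map_add, map_smul, map_smul, pullbackPair_of_J hα
        hφ.toIsBidiskImmersion hy (hφ.theta_eq_zero y hy) hJ, complex_smul_eq c]
    rw [hz, map_add, hlin, hlin]
    ext k
    fin_cases k <;>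
      simp [upperMatrix, hc, Matrix.mulVec, dotProduct, Fin.sum_univ_two, mul_comm]
  have hunit : IsUnit (upperMatrix α φ y) := by
    rw [← Matrix.mulVec_injective_iff_isUnit]
    intro z w hzw
    simp only [hup] at hzw
    have := injective_upper hn hρ hα hφ hy hzw
    ext k
    fin_cases k
    · exact congrArg Prod.fst this
    · exact congrArg Prod.snd this
  have hdet := (Matrix.isUnit_iff_isUnit_det _).1 hunit
  refine ⟨hdet, ?_⟩
  have hspec := (liftMatrix_spec hn hρ hα hφ hy).2
  have hmul : liftMatrix α φ y * upperMatrix α φ y = lowerMatrix α φ y := by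
    have h (e : ℂ × ℂ) (k : Fin 2) := congrFun (hspec e) k
    ext i j
    fin_cases i <;> fin_cases j
    · simpa [Matrix.mul_apply, Matrix.mulVec, dotProduct, Fin.sum_univ_two, upperMatrix,
        lowerMatrix, hc] using h (1, 0) 0
    · simpa [Matrix.mul_apply, Matrix.mulVec, dotProduct, Fin.sum_univ_two, upperMatrix,
        lowerMatrix, hc] using h (0, 1) 0
    · simpa [Matrix.mul_apply, Matrix.mulVec, dotProduct, Fin.sum_univ_two, upperMatrix,
        lowerMatrix, hc] using h (1, 0) 1
    · simpa [Matrix.mul_apply, Matrix.mulVec, dotProduct, Fin.sum_univ_two, upperMatrix,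
        lowerMatrix, hc] using h (0, 1) 1
  rw [← hmul, Matrix.mul_nonsing_inv_cancel_right _ _ hdet]

theorem eq_liftMatrix (hn : ∞ ≤ n) (hρ : IsDefiningFunction n Ω ρ)
    (hα : IsAdaptedCoframe n Ω ρ α) (hφ : IsHolomorphicImmersion n Ω ρ φ) (hy : y ∈ bidisk)
    {U : Mat2} (hU : ∀ e, U *ᵥ pullbackPair α φ 0 1 y e = pullbackPair α φ 2 3 y e) :
    U = liftMatrix α φ y := by
  obtain ⟨A, hA⟩ := exists_equiv_of_injective (injective_upper hn hρ hα hφ hy)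
  refine Matrix.ext_of_mulVec_single fun j => ?_
  have hj : pullbackPair α φ 0 1 y (A.symm (Pi.single j 1)) = Pi.single j 1 := by
    rw [← hA]
    exact A.apply_symm_apply _
  rw [← hj, hU, (liftMatrix_spec hn hρ hα hφ hy).2]

end

end BidiskLift

theorem proposition3p8 (n : WithTop ℕ∞) (hn : ∞ ≤ n)
    (Ω : Set BidiskLift.C5) (ρ : BidiskLift.C5 → ℝ)
    (hρ : BidiskLift.IsDefiningFunction n Ω ρ)
    (α : Fin 4 → BidiskLift.C5 → BidiskLift.C5 →L[ℝ] ℂ)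
    (hα : BidiskLift.IsAdaptedCoframe n Ω ρ α)
    (φ : ℂ × ℂ → BidiskLift.C5)
    (hφ : BidiskLift.IsBidiskImmersion n Ω ρ φ)
    (h0 : (0 : BidiskLift.C5) ∈ φ '' BidiskLift.bidisk) :
    (BidiskLift.IsHolomorphicImmersion n Ω ρ φ →
      ∃ Φ : ℂ × ℂ → BidiskLift.C5 × BidiskLift.Mat2,
        BidiskLift.IsLift n Ω ρ φ Φ ∧
        BidiskLift.IsIntegral ρ α Φ ∧
        (∀ Φ' : ℂ × ℂ → BidiskLift.C5 × BidiskLift.Mat2,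
          BidiskLift.IsLift n Ω ρ φ Φ' → BidiskLift.IsIntegral ρ α Φ' →
            Set.EqOn Φ' Φ BidiskLift.bidisk) ∧
        (DifferentiableOn ℂ φ BidiskLift.bidisk →
          ∀ y ∈ BidiskLift.bidisk,
            IsUnit (BidiskLift.upperMatrix α φ y).det ∧
            (Φ y).2 = BidiskLift.lowerMatrix α φ y * (BidiskLift.upperMatrix α φ y)⁻¹)) ∧
    (∀ Φ : ℂ × ℂ → BidiskLift.C5 × BidiskLift.Mat2,
      BidiskLift.IsLift n Ω ρ φ Φ → BidiskLift.IsIntegral ρ α Φ →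
        BidiskLift.IsHolomorphicImmersion n Ω ρ φ ∧
        (∀ y ∈ BidiskLift.bidisk, ∃ V : Set (ℂ × ℂ), IsOpen V ∧ y ∈ V ∧
          V ⊆ BidiskLift.bidisk ∧ BidiskLift.IsComplexSurface (φ '' V)) ∧
        (Topology.IsEmbedding (BidiskLift.bidisk.domRestrict φ) →
          BidiskLift.IsComplexSurface (φ '' BidiskLift.bidisk))) := by
  have h1 : (1 : WithTop ℕ∞) ≤ n := le_trans (by simp) (BidiskLift.one_add_one_le hn)
  refine ⟨fun hol => ?_, fun Φ hΦ hI => ?_⟩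
  · have hspec {y} (hy : y ∈ BidiskLift.bidisk) := BidiskLift.liftMatrix_spec hn hρ hα hol hy
    have hlift : BidiskLift.IsLift n Ω ρ φ fun y => (φ y, BidiskLift.liftMatrix α φ y) :=
      ⟨hφ.contDiffOn.prodMk (BidiskLift.contDiffOn_liftMatrix hn hρ hα hol),
        fun y hy => ⟨hφ.mapsTo hy, (hspec hy).1⟩, fun y _ => rfl⟩
    refine ⟨_, hlift, (BidiskLift.isIntegral_iff hn hlift).2 fun y hy e =>
      ⟨hol.theta_eq_zero y hy e, (hspec hy).2 e⟩, fun Φ' hΦ' hI' y hy => ?_, fun hd y hy => ?_⟩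
    · exact Prod.ext (hΦ'.proj y hy) (BidiskLift.eq_liftMatrix hn hρ hα hol hy fun e =>
        ((BidiskLift.isIntegral_iff hn hΦ').1 hI' y hy e).2)
    · exact BidiskLift.liftMatrix_eq hn hρ hα hol hy
        (hd.differentiableAt (BidiskLift.isOpen_bidisk.mem_nhds hy))
  · have hol := BidiskLift.isHolomorphicImmersion_of_isIntegral hn hα hφ hΦ hI
    have hφ1 := hφ.contDiffOn.of_le h1
    refine ⟨hol, fun y hy => ?_, fun hemb => BidiskLift.isComplexSurface_image_of_isEmbedding
      BidiskLift.isOpen_bidisk hφ1 hφ.injective_fderiv hol.J_invariant hemb⟩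
    obtain ⟨V, hV, hyV, hVW, N, hN, hVN, F, hF, hs, hS⟩ := BidiskLift.exists_local_equation
      BidiskLift.isOpen_bidisk hφ1 hφ.injective_fderiv hol.J_invariant hy
    exact ⟨V, hV, hyV, hVW, BidiskLift.isComplexSurface_of_equation hN hVN hF hs hS⟩
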